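/- Let $\psi^o_n(x)=e^{inx}/\sqrt{2\pi}$, and let $\widehat f(n)=\langle\psi^o_n,f\rangle$ denote the Fourier coefficients of a function or distribution $f$ on the circle $\mathbb R/2\pi\mathbb Z$. Let $\alpha=(\alpha_1,\alpha_2)$ be a pair of real distributions on the circle, $\widehat\alpha(n)=(\widehat\alpha_1(n),\widehat\alpha_2(n))\in\mathbb C^2$, such that for some constants $c_0$ and $0<c_1<c_2<1$ $$c_1\le|\widehat\alpha(n)\cdot\widehat\alpha(n)|\le c_2\,\widehat\alpha(n)^*\cdot\widehat\alpha(n)\le c_0\qquad\text{for all } n\in\mathbb Z\setminus\{0\},$$ where $a\cdot b=a_1b_1+a_2b_2$; put $\|\widehat\alpha\|_\infty^2=\sup_{n\in\mathbb Z}\,(|\widehat\alpha_1(n)|^2+|\widehat\alpha_2(n)|^2)$. For $v$ real, continuous and $2\pi$-periodic and $\varepsilon\in\mathbb C$ let $$h_\varepsilon=\partial_x^2-1-v-\varepsilon\sum_{i=1,2}|\alpha_i\rangle\langle\alpha_i|$$ on $L^2[0,2\pi]$ with periodic boundary conditions. An eigenfunction with eigenvalue $\mu$ is a nonzero $\psi\in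 H^1$ (taken to be continuous) with $h_\varepsilon\psi=\mu\psi$ in the sense of distributions, where $\langle\alpha_i,\psi\rangle=\sum_n\overline{\widehat\alpha_i(n)}\,\widehat\psi(n)$. For every $\kappa>0$ there is $\delta>0$ such that for every such $\alpha$ with $\kappa\|\widehat\alpha\|^2_\infty\le c_1$ and $\|\widehat\alpha\|_\infty^2\le\delta$ there are positive constants $\varepsilon_o,C,c,c'$ and $c_\gamma$ (for $\gamma<1$), with the following property. Let $v$ satisfy $\sup_x|v(x)|\le\varepsilon_o\|\widehat\alpha\|^2_\infty$, let $1/2\le|\varepsilon|\le1$, and let $\psi$ be an eigenfunction of $h_\varepsilon$ with $\|\psi\|_{L^2[0,2\pi]}=1$ and eigenvalue $\mu$. Then $|\mu+n^2+1|<1/2$ for some $n\in\mathbb Z$; and for every $n\in\mathbb Z$ with $|\mu+n^2+1|<1/2$ (so that $\psi$ is an eigenfunction of level $\pm n$, called $\psi_n$): 1. $|\langle\alpha_i,\psi\rangle|\le C$ for $i=1,2$, and $\sup_x|\psi(x)|\le C$; 2. for every $\gamma<1$ and all $x,y\in\mathbb R$ with $|x-y|\le2\pi$, $\ |\psi(x)-\psi(y)|\le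 c\left(|n||x-y|+c_\gamma|x-y|^\gamma\right)$; 3. if $|\Im\varepsilon|\le c'\,\Re\varepsilon$ and $\Re\varepsilon\ne0$, then for some $\theta\in\mathbb R$ $$\|\psi-e^{i\theta}\psi^*\|_{L^2}\le c'|\Im\varepsilon|\left(\frac1{|\Re\varepsilon|}+\frac1{|n|+1}\right),$$ where $\psi^*$ is the complex conjugate of $\psi$. In particular all these bounds are uniform in $n$, in $\varepsilon$ and in $v$. -/

import Mathlib

open scoped ContDiff

/-- Smooth complex-valued `2π`-periodic functions on the line: the test functions on the circle. -/
def PeriodicTest : Submodule ℂ (ℝ → ℂ) where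
  carrier := {φ | ContDiff ℝ ∞ φ ∧ Function.Periodic φ (2 * Real.pi)}
  add_mem' := fun hf hg => ⟨hf.1.add hg.1, hf.2.add hg.2⟩
  zero_mem' := ⟨contDiff_const, fun _ => rfl⟩
  smul_mem' := fun c _ hf => ⟨contDiff_const.smul hf.1, hf.2.smul c⟩

/-- The function `x ↦ exp (i n x)`. -/
noncomputable def expMode (n : ℤ) (x : ℝ) : ℂ := Complex.exp (Complex.I * n * x)

theorem expMode_mem (n : ℤ) : expMode n ∈ PeriodicTest := by
  constructor
  · have h : ContDiff ℝ ∞ (fun x : ℝ => (x : ℂ)) := Complex.ofRealCLM.contDiff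
    exact (contDiff_const.mul h).cexp
  · intro x
    unfold expMode
    have h : Complex.I * n * ((x + 2 * Real.pi : ℝ) : ℂ)
        = Complex.I * n * x + n * (2 * Real.pi * Complex.I) := by
      push_cast
      ring
    rw [h, Complex.exp_add, Complex.exp_int_mul_two_pi_mul_I, mul_one]

/-- A real distribution on the circle `ℝ / 2πℤ`: a linear functional on the test functions, of
finite order (that is, continuous for the smooth topology) and commuting with complex
conjugation. -/
structure RealCircleDistribution where
  toLinearMap : PeriodicTest →ₗ[ℂ] ℂ
  finite_order : ∃ (N : ℕ) (C : ℝ), ∀ (φ : PeriodicTest) (M : ℝ),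
    (∀ k ≤ N, ∀ x : ℝ, ‖iteratedDeriv k (φ : ℝ → ℂ) x‖ ≤ M) → ‖toLinearMap φ‖ ≤ C * M
  real : ∀ φ χ : PeriodicTest, (∀ x : ℝ, (χ : ℝ → ℂ) x = star ((φ : ℝ → ℂ) x)) →
    toLinearMap χ = star (toLinearMap φ)

/-- Fourier coefficient of a distribution with respect to the orthonormal basis
`exp (i n x) / √(2π)` of `L²[0, 2π]`. -/
noncomputable def RealCircleDistribution.coeff (T : RealCircleDistribution) (n : ℤ) : ℂ :=
  T.toLinearMap ⟨expMode (-n), expMode_mem (-n)⟩ / (Real.sqrt (2 * Real.pi) : ℂ)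

/-- Fourier coefficient of a function with respect to the same basis. -/
noncomputable def funCoeff (ψ : ℝ → ℂ) (n : ℤ) : ℂ :=
  (∫ x in (0 : ℝ)..(2 * Real.pi), expMode (-n) x * ψ x) / (Real.sqrt (2 * Real.pi) : ℂ)

/-- The pairing `⟨T, ψ⟩`, as the Fourier series that extends it from smooth functions. It converges
absolutely when the coefficients of `T` are bounded and `ψ` is in the Sobolev space `H¹`. -/
noncomputable def RealCircleDistribution.pair (T : RealCircleDistribution) (ψ : ℝ → ℂ) : ℂ :=
  ∑' n : ℤ, star (T.coeff n) * funCoeff ψ n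

/-- The norm of `L²[0, 2π]`. -/
noncomputable def circleL2Norm (f : ℝ → ℂ) : ℝ :=
  Real.sqrt (∫ x in (0 : ℝ)..(2 * Real.pi), ‖f x‖ ^ 2)

/-- `‖α̂‖²_∞ = sup_n (|α̂₁(n)|² + |α̂₂(n)|²)`. -/
noncomputable def coeffSupSq (α : Fin 2 → RealCircleDistribution) : ℝ :=
  ⨆ n : ℤ, ∑ i, ‖(α i).coeff n‖ ^ 2

/-- The non-degeneracy condition
`c₁ ≤ |α̂(n) · α̂(n)| ≤ c₂ (α̂(n)* · α̂(n)) ≤ c₀`, with `0 < c₁ < c₂ < 1`, for `n ≠ 0`.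
At `n = 0` the coefficients of a real `α` are real, so that `|α̂ · α̂| = α̂* · α̂` there. -/
structure NonDegenerate (α : Fin 2 → RealCircleDistribution) (c₀ c₁ c₂ : ℝ) : Prop where
  c₁_pos : 0 < c₁
  c₁_lt_c₂ : c₁ < c₂
  c₂_lt_one : c₂ < 1
  lower : ∀ n : ℤ, n ≠ 0 → c₁ ≤ ‖∑ i, (α i).coeff n * (α i).coeff n‖
  upper : ∀ n : ℤ, n ≠ 0 →
    ‖∑ i, (α i).coeff n * (α i).coeff n‖ ≤ c₂ * ∑ i, ‖(α i).coeff n‖ ^ 2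
  bounded : ∀ n : ℤ, n ≠ 0 → c₂ * ∑ i, ‖(α i).coeff n‖ ^ 2 ≤ c₀

/-- `ψ` is an `L²`-normalized eigenfunction, with eigenvalue `μ`, of
`h_ε = ∂² - 1 - v - ε ∑ᵢ |αᵢ⟩⟨αᵢ|` on the circle. Here `ψ` is the continuous representative of an
element of the form domain `H¹` and `h_ε ψ = μ ψ` holds in the sense of distributions. -/
structure IsNormalizedEigenfunction (α : Fin 2 → RealCircleDistribution) (v : ℝ → ℝ) (ε μ : ℂ)
    (ψ : ℝ → ℂ) : Prop where
  continuous : Continuous ψ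
  periodic : Function.Periodic ψ (2 * Real.pi)
  sobolev : Summable fun n : ℤ => (1 + (n : ℝ) ^ 2) * ‖funCoeff ψ n‖ ^ 2
  normalized : circleL2Norm ψ = 1
  eigen : ∀ φ : PeriodicTest,
    (∫ x in (0 : ℝ)..(2 * Real.pi), ψ x * deriv (deriv (φ : ℝ → ℂ)) x)
      - (∫ x in (0 : ℝ)..(2 * Real.pi), (1 + (v x : ℂ)) * ψ x * (φ : ℝ → ℂ) x)
      - ε * ∑ i, (α i).toLinearMap φ * (α i).pair ψ
      = μ * ∫ x in (0 : ℝ)..(2 * Real.pi), ψ x * (φ : ℝ → ℂ) x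

/-! The proof works with the Fourier coefficients `x` of `ψ` in `ℓ¹`. There the eigenvalue equation
reads `(μ + m² + 1) x m + w m + ε ∑ᵢ aᵢ(m) ⟨aᵢ, x⟩ = 0`. The last two terms are bounded, uniformly
in `m`, by a small multiple of the `ℓ¹` norm of `x`. If `μ` is near `-(n² + 1)`, division by `μ + m²
+ 1` costs `1 / |m² - n²|`, which is summable over `m ≠ ±n` with a bound independent of `n`. So the
modes off `±n` are a small part of `x`, while those at `±n` are at most 1 by normalization: this
bounds the `ℓ¹` norm, hence `sup |ψ|` and the pairings. If there is no resonance at all, then `x =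
0`. The decay `1 / |m² - n²|` leaves room for a weight `|m|^γ` with `γ < 1`, which gives the Hölder
bound (`norm_sub_le_of_level`).

For the phase, `χ = ψ - c ψ*` with `|c| = 1` solves the same equation up to an error `O(|Im ε|)`,
because `Im μ` is itself proportional to `Im ε` (`im_eigenvalue`). On the modes `±n` the operator
is, up to small terms, a 2×2 matrix with eigenvalues `Λ ± ε|q|`, where `q = α̂(n)·α̂(n)`.
Non-degeneracy keeps one of these away from zero. Conjugation preserves the modulus of the component
along the other eigenvector, so some phase `c` cancels that component of `χ`. Then all of `χ` is
controlled by the error (`exists_phase`). -/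

/-! ### Sums of `|m|^γ / |m² - n²|`, uniformly in `n`. -/

/-- The sum `∑ |k|^(γ-2)` over the nonzero integers. -/
noncomputable def absPowSum (γ : ℝ) : ℝ := ∑' k : ℤ, |(k : ℝ)| ^ (γ - 2)

theorem summable_abs_rpow_sub_two {γ : ℝ} (hγ : γ < 1) :
    Summable fun k : ℤ => |(k : ℝ)| ^ (γ - 2) := by
  have := Real.summable_abs_int_rpow (b := 2 - γ) (by linarith)
  simpa [neg_sub] using this

theorem absPowSum_nonneg (γ : ℝ) : 0 ≤ absPowSum γ :=
  tsum_nonneg fun _ => Real.rpow_nonneg (abs_nonneg _) _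

theorem absPowSum_pos {γ : ℝ} (hγ : γ < 1) : 0 < absPowSum γ :=
  (summable_abs_rpow_sub_two hγ).tsum_pos (fun _ => Real.rpow_nonneg (abs_nonneg _) _) 1 (by simp)

/-- A product `s t` with `1 ≤ s ≤ t` and `y ≤ t` satisfies `y^γ / (s t) ≤ s^(γ-2)`. -/
theorem rpow_div_mul_le {γ y s t : ℝ} (h0 : 0 ≤ γ) (h1 : γ < 1) (hy : 0 ≤ y) (hs : 1 ≤ s)
    (hst : s ≤ t) (hyt : y ≤ t) : y ^ γ / (s * t) ≤ s ^ (γ - 2) := by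
  have hs0 : 0 < s := by linarith
  have ht0 : 0 < t := by linarith
  calc y ^ γ / (s * t) ≤ t ^ γ / (s * t) := by gcongr
    _ = t ^ (γ - 1) / s := by
        rw [Real.rpow_sub_one ht0.ne']; field_simp
    _ ≤ s ^ (γ - 1) / s := by
        gcongr ?_ / s
        exact Real.rpow_le_rpow_of_nonpos hs0 hst (by linarith)
    _ = s ^ (γ - 2) := by
        rw [show γ - 2 = γ - 1 - 1 by ring, Real.rpow_sub_one hs0.ne' (γ - 1)]

/-- In `m² - n² = (m - n)(m + n)` the larger factor is at least `|m|` and absorbs `|m|^γ`. What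
remains is a power of the smaller factor, whose sum over `m` does not depend on `n`, by translation.
-/
theorem abs_rpow_div_sq_sub_sq_le {γ : ℝ} (h0 : 0 ≤ γ) (h1 : γ < 1) (m n : ℤ) :
    |(m : ℝ)| ^ γ / |(m : ℝ) ^ 2 - (n : ℝ) ^ 2|
      ≤ |((m - n : ℤ) : ℝ)| ^ (γ - 2) + |((m + n : ℤ) : ℝ)| ^ (γ - 2) := by
  have ha := Real.rpow_nonneg (abs_nonneg ((m - n : ℤ) : ℝ)) (γ - 2)
  have hb := Real.rpow_nonneg (abs_nonneg ((m + n : ℤ) : ℝ)) (γ - 2)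
  have hfac : |(m : ℝ) ^ 2 - (n : ℝ) ^ 2| = |((m - n : ℤ) : ℝ)| * |((m + n : ℤ) : ℝ)| := by
    rw [← abs_mul]; push_cast; ring_nf
  rw [hfac]
  by_cases hz : |((m - n : ℤ) : ℝ)| * |((m + n : ℤ) : ℝ)| = 0
  -- At `m = ±n` the quotient has the value 0 by the convention for division by zero.
  · rw [hz, div_zero]; positivity
  have hone : ∀ k : ℤ, |(k : ℝ)| ≠ 0 → 1 ≤ |(k : ℝ)| := fun k hk => by
    have : k ≠ 0 := by rintro rfl; simp at hk
    exact_mod_cast Int.one_le_abs this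
  have hs := hone _ (left_ne_zero_of_mul hz)
  have ht := hone _ (right_ne_zero_of_mul hz)
  have hmax : 2 * |(m : ℝ)| ≤ |((m - n : ℤ) : ℝ)| + |((m + n : ℤ) : ℝ)| := by
    have := abs_add_le ((m - n : ℤ) : ℝ) ((m + n : ℤ) : ℝ)
    rwa [show ((m - n : ℤ) : ℝ) + ((m + n : ℤ) : ℝ) = 2 * m by push_cast; ring, abs_mul,
      abs_two] at this
  rcases le_total |((m - n : ℤ) : ℝ)| |((m + n : ℤ) : ℝ)| with h | h
  · have := rpow_div_mul_le h0 h1 (abs_nonneg (m : ℝ)) hs h (by linarith)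
    linarith
  · have := rpow_div_mul_le h0 h1 (abs_nonneg (m : ℝ)) ht h (by linarith)
    rw [mul_comm] at this
    linarith

theorem hasSum_abs_rpow_shift {γ : ℝ} (h1 : γ < 1) (n : ℤ) :
    HasSum (fun m : ℤ => |((m - n : ℤ) : ℝ)| ^ (γ - 2) + |((m + n : ℤ) : ℝ)| ^ (γ - 2))
      (2 * absPowSum γ) := by
  have h := (summable_abs_rpow_sub_two h1).hasSum
  have ha := (Equiv.subRight n).hasSum_iff.mpr h
  have hb := (Equiv.addRight n).hasSum_iff.mpr h
  rw [two_mul]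
  exact ha.add hb

theorem summable_abs_rpow_div {γ : ℝ} (h0 : 0 ≤ γ) (h1 : γ < 1) (n : ℤ) :
    Summable fun m : ℤ => |(m : ℝ)| ^ γ / |(m : ℝ) ^ 2 - (n : ℝ) ^ 2| :=
  Summable.of_nonneg_of_le (fun _ => by positivity) (abs_rpow_div_sq_sub_sq_le h0 h1 · n)
    (hasSum_abs_rpow_shift h1 n).summable

theorem tsum_abs_rpow_div_le {γ : ℝ} (h0 : 0 ≤ γ) (h1 : γ < 1) (n : ℤ) :
    ∑' m : ℤ, |(m : ℝ)| ^ γ / |(m : ℝ) ^ 2 - (n : ℝ) ^ 2| ≤ 2 * absPowSum γ := by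
  rw [← (hasSum_abs_rpow_shift h1 n).tsum_eq]
  exact (summable_abs_rpow_div h0 h1 n).tsum_le_tsum (abs_rpow_div_sq_sub_sq_le h0 h1 · n)
    (hasSum_abs_rpow_shift h1 n).summable

/-! ### Splitting a sequence at the level `±n`. -/

/-- The part of a sequence away from the indices `±n`. -/
noncomputable def offLevel {E : Type*} [Zero E] (n : ℤ) (x : ℤ → E) (m : ℤ) : E :=
  open Classical in if m = n ∨ m = -n then 0 else x m

theorem sq_sub_sq_ne_zero {m n : ℤ} (h : ¬(m = n ∨ m = -n)) : (m : ℝ) ^ 2 - (n : ℝ) ^ 2 ≠ 0 := by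
  rw [← sq_eq_sq_iff_eq_or_eq_neg] at h
  rw [sub_ne_zero]
  exact_mod_cast h

theorem norm_offLevel_le (n : ℤ) (x : ℤ → ℂ) (m : ℤ) : ‖offLevel n x m‖ ≤ ‖x m‖ := by
  unfold offLevel; split_ifs <;> simp

theorem summable_offLevel {n : ℤ} {x : ℤ → ℂ} (hx : Summable fun m => ‖x m‖) :
    Summable fun m => ‖offLevel n x m‖ :=
  Summable.of_nonneg_of_le (fun _ => norm_nonneg _) (norm_offLevel_le n x) hx

/-- Only an inequality, so that `n = 0` is covered, where the single resonant mode is counted twice.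
-/
theorem tsum_norm_le_offLevel {x : ℤ → ℂ} (hx : Summable fun m => ‖x m‖) (n : ℤ) :
    ∑' m, ‖x m‖ ≤ ‖x n‖ + ‖x (-n)‖ + ∑' m, ‖offLevel n x m‖ := by
  have h := ((hasSum_ite_eq n ‖x n‖).add (hasSum_ite_eq (-n) ‖x (-n)‖)).add
    (summable_offLevel (n := n) hx).hasSum
  refine hasSum_le (fun m => ?_) hx.hasSum h
  unfold offLevel
  by_cases h1 : m = n
  · subst h1; simp; split_ifs <;> simp
  · by_cases h2 : m = -n
    · subst h2; simp [h1]
    · simp [h1, h2]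

theorem tsum_mul_eq_offLevel {b x : ℤ → ℂ} {n : ℤ} (hn : n ≠ 0)
    (h : Summable fun m => b m * offLevel n x m) :
    ∑' m, b m * x m = b n * x n + b (-n) * x (-n) + ∑' m, b m * offLevel n x m := by
  have h := ((hasSum_ite_eq n (b n * x n)).add (hasSum_ite_eq (-n) (b (-n) * x (-n)))).add h.hasSum
  rw [← h.tsum_eq]
  have hn' : n ≠ -n := by omega
  refine tsum_congr fun m => ?_
  unfold offLevel
  by_cases h1 : m = n
  · subst h1; simp [hn']
  · by_cases h2 : m = -n
    · subst h2; simp [h1]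
    · simp [h1, h2]

/-! ### Lower bounds for `|μ + m² + 1|`. -/

/-- Every complex number is, up to a factor two, as far from `m²` as some square `k²` is. -/
theorem exists_sq_sub_sq_le (μ : ℂ) :
    ∃ k : ℤ, ∀ m : ℤ, |(m : ℝ) ^ 2 - (k : ℝ) ^ 2| ≤ 2 * ‖μ + ((m : ℂ) ^ 2 + 1)‖ := by
  set l : ℝ := -(μ.re + 1) with hl
  -- Take for `k²` the square nearest to `l`; then `|m² - k²| ≤ |m² - l| + |l - k²| ≤ 2 |m² - l|`.
  have hnear : ∃ k : ℤ, ∀ m : ℤ, |(k : ℝ) ^ 2 - l| ≤ |(m : ℝ) ^ 2 - l| := by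
    have ht : Filter.Tendsto (fun m : ℤ => |(m : ℝ) ^ 2 - l|) Filter.cofinite Filter.atTop := by
      apply Filter.tendsto_abs_atTop_atTop.comp
      apply Filter.tendsto_atTop_add_const_right
      have h1 : Filter.Tendsto (fun m : ℤ => |(m : ℝ)|) Filter.cofinite Filter.atTop := by
        exact (tendsto_norm_cocompact_atTop (E := ℝ)).comp Int.tendsto_coe_cofinite
      have := (Filter.tendsto_pow_atTop (α := ℝ) (two_ne_zero)).comp h1
      simpa [Function.comp_def] using this
    exact ht.exists_forall_le
  obtain ⟨k, hk⟩ := hnear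
  refine ⟨k, fun m => ?_⟩
  have h1 : |(m : ℝ) ^ 2 - l| ≤ ‖μ + ((m : ℂ) ^ 2 + 1)‖ := by
    have := Complex.abs_re_le_norm (μ + ((m : ℂ) ^ 2 + 1))
    have h2 : (μ + ((m : ℂ) ^ 2 + 1)).re = (m : ℝ) ^ 2 - l := by
      have : ((m : ℂ) ^ 2).re = (m : ℝ) ^ 2 := by
        rw [← Complex.ofReal_intCast, ← Complex.ofReal_pow, Complex.ofReal_re]
      simp [this, hl]; ring
    rwa [h2] at this
  have h3 := abs_sub_le ((m : ℝ) ^ 2) l ((k : ℝ) ^ 2)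
  rw [abs_sub_comm l] at h3
  linarith [hk m]

/-- Distinct squares differ by at least 1, so an offset below 1/2 at `n` takes up at most half of
the gap `|m² - n²|`. -/
theorem sq_sub_sq_le_of_level {μ : ℂ} {n : ℤ} (h : ‖μ + ((n : ℂ) ^ 2 + 1)‖ < 1 / 2) (m : ℤ) :
    |(m : ℝ) ^ 2 - (n : ℝ) ^ 2| ≤ 2 * ‖μ + ((m : ℂ) ^ 2 + 1)‖ := by
  by_cases hmn : m = n ∨ m = -n
  · rw [← sq_eq_sq_iff_eq_or_eq_neg] at hmn
    have : (m : ℝ) ^ 2 = (n : ℝ) ^ 2 := by exact_mod_cast hmn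
    rw [this]; simp
  have h1 : 1 ≤ |(m : ℝ) ^ 2 - (n : ℝ) ^ 2| := by
    have : m ^ 2 - n ^ 2 ≠ 0 := by exact_mod_cast sq_sub_sq_ne_zero hmn
    exact_mod_cast Int.one_le_abs this
  have h2 : |(m : ℝ) ^ 2 - (n : ℝ) ^ 2| = ‖(μ + ((m : ℂ) ^ 2 + 1)) - (μ + ((n : ℂ) ^ 2 + 1))‖ := by
    rw [show (μ + ((m : ℂ) ^ 2 + 1)) - (μ + ((n : ℂ) ^ 2 + 1))
      = (((m : ℝ) ^ 2 - (n : ℝ) ^ 2 : ℝ) : ℂ) by push_cast; ring, Complex.norm_real, Real.norm_eq_abs]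
  have h3 := norm_sub_le (μ + ((m : ℂ) ^ 2 + 1)) (μ + ((n : ℂ) ^ 2 + 1))
  linarith

/-! ### `ℓ¹` estimates for approximate solutions. -/

/-- The pairing of two sequences, conjugate linear in the first. -/
noncomputable def seqPair (b x : ℤ → ℂ) : ℂ := ∑' k, star (b k) * x k

/-- `x` is the sequence of Fourier coefficients of an approximate solution of `(h_ε - μ) ψ = 0`,
where `a` gives the coefficients of the rank two perturbation, `w` is the contribution of the
potential, and `G` bounds the coefficients of the error. -/
structure ApproxSolution (a : Fin 2 → ℤ → ℂ) (r e G : ℝ) (ε μ : ℂ) (x w : ℤ → ℂ) : Prop where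
  r_nonneg : 0 ≤ r
  e_nonneg : 0 ≤ e
  coeff_le : ∀ i m, ‖a i m‖ ≤ r
  eps_le : ‖ε‖ ≤ 1
  summable : Summable fun m => ‖x m‖
  w_le : ∀ m, ‖w m‖ ≤ e * ∑' k, ‖x k‖
  eqn : ∀ m : ℤ, ‖(μ + ((m : ℂ) ^ 2 + 1)) * x m + w m + ε * ∑ i, a i m * seqPair (a i) x‖ ≤ G

theorem summable_star_mul {b x : ℤ → ℂ} {r : ℝ} (hb : ∀ m, ‖b m‖ ≤ r)
    (hx : Summable fun m => ‖x m‖) : Summable fun m => star (b m) * x m :=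
  Summable.of_norm_bounded (hx.mul_left r) fun m => by
    rw [norm_mul, norm_star]; gcongr; exact hb m

theorem norm_seqPair_le {b x : ℤ → ℂ} {r : ℝ} (hb : ∀ m, ‖b m‖ ≤ r)
    (hx : Summable fun m => ‖x m‖) : ‖seqPair b x‖ ≤ r * ∑' m, ‖x m‖ :=
  tsum_of_norm_bounded (hx.hasSum.mul_left r) fun m => by
    rw [norm_mul, norm_star]; gcongr; exact hb m

theorem norm_sum_two_mul_le {b p : Fin 2 → ℂ} {s t : ℝ} (hs : 0 ≤ s) (hb : ∀ i, ‖b i‖ ≤ s)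
    (hp : ∀ i, ‖p i‖ ≤ t) : ‖∑ i, b i * p i‖ ≤ 2 * (s * t) := by
  refine (norm_sum_le _ _).trans ?_
  rw [Fin.sum_univ_two, norm_mul, norm_mul]
  have h (i) : ‖b i‖ * ‖p i‖ ≤ s * t := mul_le_mul (hb i) (hp i) (norm_nonneg _) hs
  linarith [h 0, h 1]

namespace ApproxSolution

variable {a : Fin 2 → ℤ → ℂ} {r e G : ℝ} {ε μ : ℂ} {x w : ℤ → ℂ}

theorem G_nonneg (h : ApproxSolution a r e G ε μ x w) : 0 ≤ G :=
  (norm_nonneg _).trans (h.eqn 0)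

/-- Potential and rank two term map `ℓ¹` to `ℓ^∞` with norm at most `e + 2 r²`; this is the small
parameter of the perturbation argument. -/
theorem norm_mul_le (h : ApproxSolution a r e G ε μ x w) (m : ℤ) :
    ‖(μ + ((m : ℂ) ^ 2 + 1)) * x m‖ ≤ (e + 2 * r ^ 2) * ∑' k, ‖x k‖ + G := by
  have h1 := norm_sum_two_mul_le (b := fun i => a i m) h.r_nonneg (fun i => h.coeff_le i m)
    (fun i => norm_seqPair_le (h.coeff_le i) h.summable)
  set s := ∑ i, a i m * seqPair (a i) x
  have h2 : ‖ε * s‖ ≤ 1 * ‖s‖ := by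
    rw [norm_mul]; gcongr; exact h.eps_le
  have h3 : ‖(μ + ((m : ℂ) ^ 2 + 1)) * x m‖
      ≤ ‖(μ + ((m : ℂ) ^ 2 + 1)) * x m + w m + ε * s‖ + ‖w m‖ + ‖ε * s‖ := by
    have := norm_sub_le ((μ + ((m : ℂ) ^ 2 + 1)) * x m + w m + ε * s - w m) (ε * s)
    have := norm_sub_le ((μ + ((m : ℂ) ^ 2 + 1)) * x m + w m + ε * s) (w m)
    rw [show (μ + ((m : ℂ) ^ 2 + 1)) * x m
      = (μ + ((m : ℂ) ^ 2 + 1)) * x m + w m + ε * s - w m - ε * s by ring]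
    rw [show (μ + ((m : ℂ) ^ 2 + 1)) * x m + w m + ε * s - w m - ε * s + w m + ε * s
      = (μ + ((m : ℂ) ^ 2 + 1)) * x m + w m + ε * s by ring]
    linarith
  linarith [h.eqn m, h.w_le m]

theorem norm_offLevel_le (h : ApproxSolution a r e G ε μ x w) {n : ℤ}
    (hn : ∀ m : ℤ, |(m : ℝ) ^ 2 - (n : ℝ) ^ 2| ≤ 2 * ‖μ + ((m : ℂ) ^ 2 + 1)‖) (m : ℤ) :
    ‖offLevel n x m‖ ≤ 2 * ((e + 2 * r ^ 2) * ∑' k, ‖x k‖ + G) / |(m : ℝ) ^ 2 - (n : ℝ) ^ 2| := by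
  have h0 := h.norm_mul_le m
  have h1 := (norm_nonneg _).trans h0
  unfold offLevel
  split_ifs with hm
  · rw [norm_zero]; positivity
  · rw [le_div_iff₀ (abs_pos.mpr (sq_sub_sq_ne_zero hm))]
    rw [norm_mul] at h0
    nlinarith [hn m, norm_nonneg (x m)]

theorem tsum_offLevel_le (h : ApproxSolution a r e G ε μ x w) {n : ℤ}
    (hn : ∀ m : ℤ, |(m : ℝ) ^ 2 - (n : ℝ) ^ 2| ≤ 2 * ‖μ + ((m : ℂ) ^ 2 + 1)‖) :
    ∑' m, ‖offLevel n x m‖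
      ≤ 4 * absPowSum 0 * ((e + 2 * r ^ 2) * ∑' k, ‖x k‖ + G) := by
  have h1 := (norm_nonneg _).trans (h.norm_mul_le 0)
  set Q := (e + 2 * r ^ 2) * ∑' k, ‖x k‖ + G
  have h2 := summable_abs_rpow_div le_rfl one_pos n
  have h3 := tsum_abs_rpow_div_le le_rfl one_pos n
  calc ∑' m, ‖offLevel n x m‖
      ≤ ∑' m : ℤ, 2 * Q * (|(m : ℝ)| ^ (0 : ℝ) / |(m : ℝ) ^ 2 - (n : ℝ) ^ 2|) := by
        refine (summable_offLevel h.summable).tsum_le_tsum (fun m => ?_) (h2.mul_left _)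
        rw [Real.rpow_zero, mul_one_div]
        exact h.norm_offLevel_le hn m
    _ ≤ 4 * absPowSum 0 * Q := by
        rw [tsum_mul_left]
        nlinarith

/-- An exact solution that is nowhere resonant vanishes. -/
theorem tsum_le_zero_of_not_level (h : ApproxSolution a r e 0 ε μ x w)
    (hsmall : (4 * absPowSum 0 + 4) * (e + 2 * r ^ 2) < 1)
    (hμ : ∀ n : ℤ, 1 / 2 ≤ ‖μ + ((n : ℂ) ^ 2 + 1)‖) : ∑' m, ‖x m‖ ≤ 0 := by
  obtain ⟨k, hk⟩ := exists_sq_sub_sq_le μ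
  have h1 := tsum_norm_le_offLevel h.summable k
  have h2 := h.tsum_offLevel_le hk
  have h3 (m : ℤ) : ‖x m‖ ≤ 2 * ((e + 2 * r ^ 2) * ∑' k, ‖x k‖ + 0) := by
    -- Each of the modes `±k` is bounded through `|μ + m² + 1| ≥ 1/2`; the two factors 2 add up to
    -- the 4 in `hsmall`.
    have := h.norm_mul_le m
    rw [norm_mul] at this
    nlinarith [hμ m, norm_nonneg (x m)]
  nlinarith [h3 k, h3 (-k)]

/-- If the part of an approximate solution at level `±n` is controlled, so is the solution. -/
theorem tsum_le_of_level (h : ApproxSolution a r e G ε μ x w) {n : ℤ}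
    (hn : ∀ m : ℤ, |(m : ℝ) ^ 2 - (n : ℝ) ^ 2| ≤ 2 * ‖μ + ((m : ℂ) ^ 2 + 1)‖) :
    ∑' m, ‖x m‖ ≤ ‖x n‖ + ‖x (-n)‖
      + 4 * absPowSum 0 * ((e + 2 * r ^ 2) * ∑' k, ‖x k‖ + G) := by
  linarith [tsum_norm_le_offLevel h.summable n, h.tsum_offLevel_le hn]

/-- The equations at `±n`, with the coupling between these two modes made explicit. -/
theorem exists_level_equations (h : ApproxSolution a r e G ε μ x w)
    (hreal : ∀ i m, a i (-m) = star (a i m)) {n : ℤ} (hn0 : n ≠ 0)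
    (hn : ∀ m : ℤ, |(m : ℝ) ^ 2 - (n : ℝ) ^ 2| ≤ 2 * ‖μ + ((m : ℂ) ^ 2 + 1)‖) (m : ℤ) :
    ‖(μ + ((m : ℂ) ^ 2 + 1)) * x m
        + ε * ∑ i, a i m * (star (a i n) * x n + a i n * x (-n))‖
      ≤ e * ∑' k, ‖x k‖ + G
        + 2 * r ^ 2 * (4 * absPowSum 0 * ((e + 2 * r ^ 2) * ∑' k, ‖x k‖ + G)) := by
  have hR (i) : ‖seqPair (a i) (offLevel n x)‖
      ≤ r * (4 * absPowSum 0 * ((e + 2 * r ^ 2) * ∑' k, ‖x k‖ + G)) :=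
    (norm_seqPair_le (h.coeff_le i) (summable_offLevel h.summable)).trans
      (mul_le_mul_of_nonneg_left (h.tsum_offLevel_le hn) h.r_nonneg)
  have hp (i) : seqPair (a i) x
      = star (a i n) * x n + a i n * x (-n) + seqPair (a i) (offLevel n x) := by
    have := tsum_mul_eq_offLevel (b := fun k => star (a i k)) (x := x) hn0
      (summable_star_mul (h.coeff_le i) (summable_offLevel h.summable))
    simpa [seqPair, hreal] using this
  have h1 := norm_sum_two_mul_le (b := fun i => a i m) h.r_nonneg (fun i => h.coeff_le i m) hR
  have h2 := h.eqn m
  simp only [hp, mul_add _ _ (seqPair _ _), Finset.sum_add_distrib] at h2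
  set s := ∑ i, a i m * seqPair (a i) (offLevel n x)
  set t := ∑ i, a i m * (star (a i n) * x n + a i n * x (-n))
  have h3 : ‖ε * s‖ ≤ 1 * ‖s‖ := by
    rw [norm_mul]; gcongr; exact h.eps_le
  have h4 := norm_sub_le ((μ + ((m : ℂ) ^ 2 + 1)) * x m + w m + (ε * t + ε * s) - w m) (ε * s)
  have h5 := norm_sub_le ((μ + ((m : ℂ) ^ 2 + 1)) * x m + w m + (ε * t + ε * s)) (w m)
  rw [show (μ + ((m : ℂ) ^ 2 + 1)) * x m + w m + (ε * t + ε * s) - w m - ε * s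
    = (μ + ((m : ℂ) ^ 2 + 1)) * x m + ε * t by ring] at h4
  rw [mul_add ε t s] at h2
  linarith [h.w_le m]

end ApproxSolution

/-! ### The 2×2 block on the modes `±n`. -/

/-- The combination `x + s ω y` of a two-vector, with `ω` the phase of `q`. -/
noncomputable def phaseComb (q s x y : ℂ) : ℂ := x + s * (q / ‖q‖) * y

/-- A hermitian matrix with diagonal `l`, off-diagonal `q`, acts on `phaseComb q s` by
`l + s |q|`. -/
theorem norm_mul_phaseComb_le {q s x y Λ ε : ℂ} {E : ℝ} (hq : q ≠ 0) (hs : s * s = 1)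
    (h1 : ‖Λ * x + ε * (q * y)‖ ≤ E) (h2 : ‖Λ * y + ε * (star q * x)‖ ≤ E) :
    ‖Λ + s * ε * ‖q‖‖ * ‖phaseComb q s x y‖ ≤ 2 * E := by
  have hq' : (‖q‖ : ℂ) ≠ 0 := by simpa using hq
  have hsn : ‖s‖ = 1 := by
    have : ‖s‖ * ‖s‖ = 1 := by rw [← norm_mul, hs, norm_one]
    nlinarith [norm_nonneg s]
  have hqq : q * star q = (‖q‖ : ℂ) * ‖q‖ := by
    have := Complex.mul_conj' q
    rw [sq] at this; exact this
  have key : (Λ + s * ε * ‖q‖) * phaseComb q s x y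
      = (Λ * x + ε * (q * y)) + s * (q / ‖q‖) * (Λ * y + ε * (star q * x)) := by
    unfold phaseComb
    field_simp
    linear_combination (ε * q * ‖q‖ * y) * hs - (s * ε * x) * hqq
  rw [← norm_mul, key]
  refine (norm_add_le _ _).trans ?_
  have : ‖s * (q / (‖q‖ : ℂ))‖ = 1 := by
    rw [norm_mul, hsn, norm_div, Complex.norm_real, norm_norm, one_mul, div_self (by simpa using hq)]
  rw [norm_mul, this]
  linarith

theorem norm_add_norm_le_of_phaseComb {q s x y : ℂ} (hq : q ≠ 0) (hs : s * s = 1)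
    (h0 : phaseComb q (-s) x y = 0) : ‖x‖ + ‖y‖ ≤ ‖phaseComb q s x y‖ := by
  have hsn : ‖s‖ = 1 := by
    have : ‖s‖ * ‖s‖ = 1 := by rw [← norm_mul, hs, norm_one]
    nlinarith [norm_nonneg s]
  have hω : ‖s * (q / (‖q‖ : ℂ))‖ = 1 := by
    rw [norm_mul, hsn, norm_div, Complex.norm_real, norm_norm, one_mul, div_self (by simpa using hq)]
  have hx : x = s * (q / ‖q‖) * y := by
    unfold phaseComb at h0; linear_combination h0
  have hy : ‖x‖ = ‖y‖ := by rw [hx, norm_mul, hω, one_mul]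
  have : phaseComb q s x y = 2 * x := by unfold phaseComb; rw [← hx]; ring
  rw [this, norm_mul, ← hy]; norm_num; linarith

/-- One of two points whose distance is `2 |ε q|` is at least `|ε q|` away from zero. -/
theorem exists_sign_le {Λ ε q : ℂ} : ∃ s : ℂ, s * s = 1 ∧ ‖ε‖ * ‖q‖ ≤ ‖Λ + s * ε * ‖q‖‖ := by
  by_contra! hcon
  have h1 := hcon 1 (by norm_num)
  have h2 := hcon (-1) (by norm_num)
  have h3 := norm_sub_le (Λ + 1 * ε * ‖q‖) (Λ + -1 * ε * ‖q‖)
  rw [show (Λ + 1 * ε * ‖q‖) - (Λ + -1 * ε * ‖q‖) = 2 * (ε * ‖q‖) by ring, norm_mul, norm_mul,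
    Complex.norm_real, norm_norm] at h3
  norm_num at h3 h1 h2
  linarith

namespace ApproxSolution

variable {a : Fin 2 → ℤ → ℂ} {r e G : ℝ} {ε μ : ℂ} {x w : ℤ → ℂ}

/-- The two modes at level `±n` are controlled when the combination that may be resonant
vanishes. -/
theorem norm_level_le (h : ApproxSolution a r e G ε μ x w)
    (hreal : ∀ i m, a i (-m) = star (a i m)) {n : ℤ} (hn0 : n ≠ 0)
    (hn : ∀ m : ℤ, |(m : ℝ) ^ 2 - (n : ℝ) ^ 2| ≤ 2 * ‖μ + ((m : ℂ) ^ 2 + 1)‖)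
    {c₁ : ℝ} (hc₁ : 0 < c₁) (hq : c₁ ≤ ‖∑ i, a i n * a i n‖) (hε : 1 / 2 ≤ ‖ε‖) {s : ℂ}
    (hs : s * s = 1)
    (hsε : ‖ε‖ * ‖∑ i, a i n * a i n‖
      ≤ ‖(μ + ((n : ℂ) ^ 2 + 1) + ε * ∑ i, a i n * star (a i n))
        + s * ε * ‖∑ i, a i n * a i n‖‖)
    (h0 : phaseComb (∑ i, a i n * a i n) (-s) (x n) (x (-n)) = 0) :
    ‖x n‖ + ‖x (-n)‖ ≤ 4 / c₁ * (e * ∑' k, ‖x k‖ + G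
        + 2 * r ^ 2 * (4 * absPowSum 0 * ((e + 2 * r ^ 2) * ∑' k, ‖x k‖ + G))) := by
  have e1 := h.exists_level_equations hreal hn0 hn n
  have e2 := h.exists_level_equations hreal hn0 hn (-n)
  set E := e * ∑' k, ‖x k‖ + G
        + 2 * r ^ 2 * (4 * absPowSum 0 * ((e + 2 * r ^ 2) * ∑' k, ‖x k‖ + G))
  set q := ∑ i, a i n * a i n with hqdef
  set l := ∑ i, a i n * star (a i n) with hl
  have hq0 : q ≠ 0 := norm_pos_iff.mp (hc₁.trans_le hq)
  -- The coefficients at `-n` are the conjugates of those at `n`, so both modes have the same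
  -- diagonal entry `l`, and the off-diagonal entries are `q` and its conjugate.
  have e1' : ‖(μ + ((n : ℂ) ^ 2 + 1) + ε * l) * x n + ε * (q * x (-n))‖ ≤ E := by
    convert e1 using 2
    rw [hl, hqdef]; simp only [Fin.sum_univ_two]; ring
  have e2' : ‖(μ + ((n : ℂ) ^ 2 + 1) + ε * l) * x (-n) + ε * (star q * x n)‖ ≤ E := by
    convert e2 using 2
    rw [hl, hqdef]; simp only [Fin.sum_univ_two, hreal, star_add, star_mul']; push_cast; ring
  have h1 := norm_mul_phaseComb_le hq0 hs e1' e2'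
  have h2 := norm_add_norm_le_of_phaseComb hq0 hs h0
  refine h2.trans ?_
  rw [div_mul_eq_mul_div, le_div_iff₀ hc₁]
  -- The gap is at least `|ε| |q| ≥ c₁ / 2`, which together with the bound `2 E` gives the constant
  -- `4 / c₁`.
  have h3 : c₁ ≤ 2 * ‖μ + ((n : ℂ) ^ 2 + 1) + ε * l + s * ε * ‖q‖‖ := by nlinarith
  nlinarith [norm_nonneg (phaseComb q s (x n) (x (-n)))]

end ApproxSolution

/-! ### Fourier series on the circle. -/

theorem continuous_expMode (n : ℤ) : Continuous (expMode n) :=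
  ((expMode_mem n).1).continuous

theorem norm_expMode (n : ℤ) (x : ℝ) : ‖expMode n x‖ = 1 := by
  unfold expMode
  rw [show Complex.I * n * x = ((n * x : ℝ) : ℂ) * Complex.I by push_cast; ring,
    Complex.norm_exp_ofReal_mul_I]

theorem star_expMode (n : ℤ) (x : ℝ) : star (expMode n x) = expMode (-n) x := by
  unfold expMode
  rw [Complex.star_def, ← Complex.exp_conj]
  simp

theorem norm_expMode_sub_le (n : ℤ) (x y : ℝ) :
    ‖expMode n x - expMode n y‖ ≤ |(n : ℝ)| * |x - y| := by
  have h : expMode n x - expMode n y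
      = expMode n y * (Complex.exp (Complex.I * ((n * (x - y) : ℝ) : ℂ)) - 1) := by
    unfold expMode
    rw [mul_sub, ← Complex.exp_add, mul_one]
    congr 2
    push_cast; ring
  rw [h, norm_mul, norm_expMode, one_mul, ← abs_mul]
  exact Real.norm_exp_I_mul_ofReal_sub_one_le

/-- Hölder continuity of the Fourier modes. -/
theorem norm_expMode_sub_le_rpow {γ : ℝ} (h0 : 0 ≤ γ) (h1 : γ ≤ 1) (n : ℤ) (x y : ℝ) :
    ‖expMode n x - expMode n y‖ ≤ 2 * (|(n : ℝ)| ^ γ * |x - y| ^ γ) := by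
  rw [← Real.mul_rpow (abs_nonneg _) (abs_nonneg _)]
  have hl := norm_expMode_sub_le n x y
  set t := |(n : ℝ)| * |x - y| with ht
  have ht0 : 0 ≤ t := by positivity
  rcases le_total t 1 with h | h
  · have : t ≤ t ^ γ := by
      rcases ht0.eq_or_lt with h' | h'
      · rw [← h']; positivity
      · simpa using Real.rpow_le_rpow_of_exponent_ge h' h h1
    linarith [Real.rpow_nonneg ht0 γ]
  · have h2 := norm_sub_le (expMode n x) (expMode n y)
    rw [norm_expMode, norm_expMode] at h2
    linarith [Real.one_le_rpow h h0]

theorem sqrt_two_pi_ge_one : 1 ≤ Real.sqrt (2 * Real.pi) := by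
  rw [Real.one_le_sqrt]; linarith [Real.pi_gt_three]

theorem funCoeff_star (ψ : ℝ → ℂ) (n : ℤ) :
    funCoeff (fun x => star (ψ x)) n = star (funCoeff ψ (-n)) := by
  unfold funCoeff
  have hpi : 0 ≤ 2 * Real.pi := by positivity
  rw [Complex.star_def, map_div₀, Complex.conj_ofReal, intervalIntegral.integral_of_le hpi,
    intervalIntegral.integral_of_le hpi, ← integral_conj]
  congr 2
  ext x
  rw [map_mul, ← Complex.star_def, star_expMode, neg_neg]

theorem funCoeff_sub_mul {f g : ℝ → ℂ} (hf : Continuous f) (hg : Continuous g) (c : ℂ) (n : ℤ) :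
    funCoeff (fun x => f x - c * g x) n = funCoeff f n - c * funCoeff g n := by
  unfold funCoeff
  have : ∀ x, expMode (-n) x * (f x - c * g x)
      = expMode (-n) x * f x - c * (expMode (-n) x * g x) := fun x => by ring
  simp only [this]
  rw [intervalIntegral.integral_sub, intervalIntegral.integral_const_mul]
  · ring
  · exact ((continuous_expMode _).mul hf).intervalIntegrable _ _
  · exact (continuous_const.mul ((continuous_expMode _).mul hg)).intervalIntegrable _ _

theorem norm_funCoeff_le {f : ℝ → ℂ} {M : ℝ} (hf : ∀ x, ‖f x‖ ≤ M) (n : ℤ) :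
    ‖funCoeff f n‖ ≤ Real.sqrt (2 * Real.pi) * M := by
  unfold funCoeff
  have hpi : 0 < 2 * Real.pi := by positivity
  have h := intervalIntegral.norm_integral_le_of_norm_le_const (a := 0) (b := 2 * Real.pi)
    (f := fun x => expMode (-n) x * f x) (C := M)
    (fun x _ => by rw [norm_mul, norm_expMode, one_mul]; exact hf x)
  rw [sub_zero, abs_of_pos hpi] at h
  rw [norm_div, Complex.norm_real, Real.norm_of_nonneg (Real.sqrt_nonneg _),
    div_le_iff₀ (Real.sqrt_pos.mpr hpi)]
  calc _ ≤ _ := h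
    _ = M * (Real.sqrt (2 * Real.pi) * Real.sqrt (2 * Real.pi)) := by
      rw [Real.mul_self_sqrt hpi.le]
    _ = _ := by ring

/-- A continuous periodic function with summable Fourier coefficients is the sum of its Fourier
series. -/
theorem hasSum_funCoeff_mul_expMode {ψ : ℝ → ℂ} (hc : Continuous ψ)
    (hp : Function.Periodic ψ (2 * Real.pi)) (hs : Summable fun m => ‖funCoeff ψ m‖) (x : ℝ) :
    HasSum (fun m => funCoeff ψ m * expMode m x / (Real.sqrt (2 * Real.pi) : ℂ)) (ψ x) := by
  have hpi : 0 < 2 * Real.pi := by positivity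
  have : Fact (0 < 2 * Real.pi) := ⟨hpi⟩
  let f : C(AddCircle (2 * Real.pi), ℂ) := ⟨hp.lift, continuous_coinduced_dom.mpr hc⟩
  have hfx (y : ℝ) : f (y : AddCircle (2 * Real.pi)) = ψ y := hp.lift_coe y
  have he (m : ℤ) (y : ℝ) : fourier m (y : AddCircle (2 * Real.pi)) = expMode m y := by
    rw [fourier_coe_apply, expMode]
    congr 1
    have : (Real.pi : ℂ) ≠ 0 := by exact_mod_cast Real.pi_ne_zero
    push_cast
    field_simp
  have hsq : (Real.sqrt (2 * Real.pi) : ℂ) * (Real.sqrt (2 * Real.pi) : ℂ)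
      = ((2 * Real.pi : ℝ) : ℂ) := by
    rw [← Complex.ofReal_mul, Real.mul_self_sqrt hpi.le]
  have hsq0 : (Real.sqrt (2 * Real.pi) : ℂ) ≠ 0 := by
    exact_mod_cast (Real.sqrt_pos.mpr hpi).ne'
  have hcoef (m : ℤ) : fourierCoeff f m = funCoeff ψ m / (Real.sqrt (2 * Real.pi) : ℂ) := by
    rw [fourierCoeff_eq_intervalIntegral f m 0, zero_add, funCoeff, div_div, hsq]
    simp only [he, hfx, smul_eq_mul]
    rw [Complex.real_smul, div_eq_inv_mul]
    push_cast; ring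
  have hsum : Summable (fourierCoeff f) := by
    have : Summable fun m => funCoeff ψ m / (Real.sqrt (2 * Real.pi) : ℂ) :=
      hs.of_norm.div_const _
    exact this.congr fun m => (hcoef m).symm
  have := has_pointwise_sum_fourier_series_of_summable hsum (x : AddCircle (2 * Real.pi))
  rw [hfx] at this
  refine this.congr_fun fun m => ?_
  rw [hcoef, he, smul_eq_mul]; ring

theorem norm_le_tsum_funCoeff {ψ : ℝ → ℂ} (hc : Continuous ψ)
    (hp : Function.Periodic ψ (2 * Real.pi)) (hs : Summable fun m => ‖funCoeff ψ m‖) (x : ℝ) :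
    ‖ψ x‖ ≤ (∑' m, ‖funCoeff ψ m‖) / Real.sqrt (2 * Real.pi) := by
  rw [← (hasSum_funCoeff_mul_expMode hc hp hs x).tsum_eq]
  refine tsum_of_norm_bounded (hs.hasSum.div_const _) fun m => ?_
  rw [norm_div, norm_mul, norm_expMode, mul_one, Complex.norm_real,
    Real.norm_of_nonneg (Real.sqrt_nonneg _)]

theorem circleL2Norm_le_tsum_funCoeff {ψ : ℝ → ℂ} (hc : Continuous ψ)
    (hp : Function.Periodic ψ (2 * Real.pi)) (hs : Summable fun m => ‖funCoeff ψ m‖) :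
    circleL2Norm ψ ≤ ∑' m, ‖funCoeff ψ m‖ := by
  have hpi : 0 < 2 * Real.pi := by positivity
  have hN : 0 ≤ ∑' m, ‖funCoeff ψ m‖ := tsum_nonneg fun _ => norm_nonneg _
  unfold circleL2Norm
  refine Real.sqrt_le_iff.mpr ⟨hN, ?_⟩
  have h := intervalIntegral.norm_integral_le_of_norm_le_const (a := 0) (b := 2 * Real.pi)
    (f := fun x => ‖ψ x‖ ^ 2) (C := (∑' m, ‖funCoeff ψ m‖) ^ 2 / (2 * Real.pi))
    (fun x _ => by
      have := norm_le_tsum_funCoeff hc hp hs x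
      rw [norm_pow, norm_norm]
      calc ‖ψ x‖ ^ 2 ≤ _ := pow_le_pow_left₀ (norm_nonneg _) this 2
        _ = _ := by rw [div_pow, Real.sq_sqrt hpi.le])
  rw [sub_zero, abs_of_pos hpi, div_mul_cancel₀ _ hpi.ne'] at h
  exact (Real.le_norm_self _).trans h

/-- The factor `√(2π)` from integrating over the circle cancels the one gained in bounding `sup |ψ|`
by the `ℓ¹` norm of its coefficients. -/
theorem norm_funCoeff_mul_le {v : ℝ → ℝ} {V : ℝ} (hv : ∀ x, |v x| ≤ V) {ψ : ℝ → ℂ}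
    (hc : Continuous ψ) (hp : Function.Periodic ψ (2 * Real.pi))
    (hs : Summable fun m => ‖funCoeff ψ m‖) (n : ℤ) :
    ‖funCoeff (fun x => v x * ψ x) n‖ ≤ V * ∑' m, ‖funCoeff ψ m‖ := by
  have hpi : 0 < Real.sqrt (2 * Real.pi) := by positivity
  refine (norm_funCoeff_le (M := V * ((∑' m, ‖funCoeff ψ m‖) / Real.sqrt (2 * Real.pi)))
    (fun x => ?_) n).trans_eq (by field_simp)
  rw [norm_mul, Complex.norm_real, Real.norm_eq_abs]
  exact mul_le_mul (hv x) (norm_le_tsum_funCoeff hc hp hs x) (norm_nonneg _)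
    ((abs_nonneg _).trans (hv x))

/-- Parseval's identity. -/
theorem hasSum_star_funCoeff_mul {ψ f : ℝ → ℂ} (hc : Continuous ψ)
    (hp : Function.Periodic ψ (2 * Real.pi)) (hs : Summable fun m => ‖funCoeff ψ m‖)
    (hf : Continuous f) :
    HasSum (fun m => star (funCoeff ψ m) * funCoeff f m)
      (∫ x in (0 : ℝ)..(2 * Real.pi), star (ψ x) * f x) := by
  have hpi : 0 < 2 * Real.pi := by positivity
  obtain ⟨M, hM⟩ := isCompact_Icc.exists_bound_of_continuousOn (s := Set.Icc 0 (2 * Real.pi))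
    hf.continuousOn
  have hexp (m : ℤ) : star (funCoeff ψ m) * funCoeff f m = ∫ x in (0 : ℝ)..(2 * Real.pi),
      star (funCoeff ψ m * expMode m x / (Real.sqrt (2 * Real.pi) : ℂ)) * f x := by
    rw [funCoeff.eq_def f, mul_div_assoc', mul_comm, ← intervalIntegral.integral_mul_const,
      ← intervalIntegral.integral_div]
    congr 1
    ext x
    rw [star_div₀, star_mul', star_expMode, Complex.star_def, Complex.conj_ofReal]
    ring
  simp only [hexp]
  -- Only `ψ` is expanded. The function `f` will also be `v ψ`, for which continuity of `v` does not
  -- give summable coefficients.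
  refine intervalIntegral.hasSum_integral_of_dominated_convergence
    (fun m _ => ‖funCoeff ψ m‖ * |M|) (fun m => ?_) (fun m => ?_) ?_ ?_ ?_
  · apply Continuous.aestronglyMeasurable
    have := continuous_expMode m
    exact (continuous_star.comp ((continuous_const.mul this).div_const _)).mul hf
  · refine Filter.Eventually.of_forall fun x hx => ?_
    rw [Set.uIoc_of_le hpi.le] at hx
    have hfx := (hM x ⟨hx.1.le, hx.2⟩).trans (le_abs_self M)
    rw [norm_mul, norm_star, norm_div, norm_mul, norm_expMode, mul_one, Complex.norm_real,
      Real.norm_of_nonneg (Real.sqrt_nonneg _)]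
    exact mul_le_mul (div_le_self (norm_nonneg _) sqrt_two_pi_ge_one) hfx (norm_nonneg _)
      (norm_nonneg _)
  · exact Filter.Eventually.of_forall fun x _ => hs.mul_right _
  · exact _root_.intervalIntegrable_const
  · refine Filter.Eventually.of_forall fun x _ => ?_
    exact ((hasSum_funCoeff_mul_expMode hc hp hs x).star).mul_right _

theorem summable_norm_of_sobolev {x : ℤ → ℂ}
    (hs : Summable fun n : ℤ => (1 + (n : ℝ) ^ 2) * ‖x n‖ ^ 2) : Summable fun n => ‖x n‖ := by
  have h1 : Summable fun n : ℤ => 1 / (1 + (n : ℝ) ^ 2) := by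
    have h2 : Summable fun n : ℤ => 1 / (n : ℝ) ^ 2 + if n = 0 then (1 : ℝ) else 0 :=
      (Real.summable_one_div_int_pow.mpr one_lt_two).add (hasSum_ite_eq 0 1).summable
    refine Summable.of_nonneg_of_le (fun _ => by positivity) (fun n => ?_) h2
    by_cases hn : n = 0
    · subst hn; simp
    · have : (0 : ℝ) < (n : ℝ) ^ 2 := by positivity
      simp only [hn, if_false, add_zero]
      gcongr
      linarith
  refine Summable.of_nonneg_of_le (fun _ => norm_nonneg _) (fun n => ?_) (h1.add hs)
  have h3 : 0 < 1 + (n : ℝ) ^ 2 := by positivity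
  -- With `u = (1 + n²) ‖x n‖`, the claim is `u ≤ 1 + u²`, and `1 + u² - u = (1 - u)² + u`.
  rw [← sub_nonneg]
  have : 1 / (1 + (n : ℝ) ^ 2) + (1 + (n : ℝ) ^ 2) * ‖x n‖ ^ 2 - ‖x n‖
      = ((1 - (1 + (n : ℝ) ^ 2) * ‖x n‖) ^ 2 + (1 + (n : ℝ) ^ 2) * ‖x n‖) / (1 + (n : ℝ) ^ 2) := by
    field_simp; ring
  rw [this]
  positivity

/-! ### The eigenvalue equation for Fourier coefficients. -/

theorem RealCircleDistribution.coeff_neg (T : RealCircleDistribution) (n : ℤ) :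
    T.coeff (-n) = star (T.coeff n) := by
  unfold RealCircleDistribution.coeff
  have h := T.real ⟨expMode (-n), expMode_mem (-n)⟩ ⟨expMode (- -n), expMode_mem (- -n)⟩
    (fun x => (star_expMode (-n) x).symm)
  rw [h, star_div₀, Complex.star_def, Complex.conj_ofReal]

theorem deriv_expMode (n : ℤ) : deriv (expMode n) = fun x => Complex.I * n * expMode n x := by
  ext x
  have h : HasDerivAt (fun x : ℝ => Complex.I * n * (x : ℂ)) (Complex.I * n * 1) x :=
    (Complex.ofRealCLM.hasDerivAt (x := x)).const_mul _
  have := h.cexp.deriv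
  change deriv (fun x : ℝ => Complex.exp (Complex.I * n * (x : ℂ))) x = _
  rw [this]; unfold expMode; ring

theorem deriv_deriv_expMode (n : ℤ) :
    deriv (deriv (expMode n)) = fun x => -(n : ℂ) ^ 2 * expMode n x := by
  rw [deriv_expMode]
  ext x
  rw [deriv_const_mul_field, deriv_expMode]
  linear_combination ((n : ℂ) ^ 2 * expMode n x) * Complex.I_sq

/-- The eigenvalue equation in Fourier space. -/
theorem IsNormalizedEigenfunction.coeff_eq {α : Fin 2 → RealCircleDistribution} {v : ℝ → ℝ}
    {ε μ : ℂ} {ψ : ℝ → ℂ} (h : IsNormalizedEigenfunction α v ε μ ψ) (hv : Continuous v) (m : ℤ) :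
    (μ + ((m : ℂ) ^ 2 + 1)) * funCoeff ψ m + funCoeff (fun x => v x * ψ x) m
      + ε * ∑ i, (α i).coeff m * (α i).pair ψ = 0 := by
  have hpi : 0 < Real.sqrt (2 * Real.pi) := by positivity
  have hsq0 : (Real.sqrt (2 * Real.pi) : ℂ) ≠ 0 := by exact_mod_cast hpi.ne'
  have hE := h.eigen ⟨expMode (-m), expMode_mem (-m)⟩
  have hψ := h.continuous
  have hv' : Continuous fun x => (v x : ℂ) := Complex.continuous_ofReal.comp hv
  have he := continuous_expMode (-m)
  have i1 : (∫ x in (0 : ℝ)..(2 * Real.pi), ψ x * deriv (deriv (expMode (-m))) x)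
      = -(m : ℂ) ^ 2 * ∫ x in (0 : ℝ)..(2 * Real.pi), expMode (-m) x * ψ x := by
    rw [deriv_deriv_expMode, ← intervalIntegral.integral_const_mul]
    congr 1; ext x; push_cast; ring
  have i2 : (∫ x in (0 : ℝ)..(2 * Real.pi), (1 + (v x : ℂ)) * ψ x * expMode (-m) x)
      = (∫ x in (0 : ℝ)..(2 * Real.pi), expMode (-m) x * ψ x)
        + ∫ x in (0 : ℝ)..(2 * Real.pi), expMode (-m) x * (v x * ψ x) := by
    have j1 : Continuous fun x => expMode (-m) x * ψ x := he.mul hψ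
    have j2 : Continuous fun x => expMode (-m) x * (v x * ψ x) := he.mul (hv'.mul hψ)
    rw [← intervalIntegral.integral_add (j1.intervalIntegrable _ _) (j2.intervalIntegrable _ _)]
    congr 1; ext x; ring
  have i3 : (∫ x in (0 : ℝ)..(2 * Real.pi), ψ x * expMode (-m) x)
      = ∫ x in (0 : ℝ)..(2 * Real.pi), expMode (-m) x * ψ x := by
    congr 1; ext x; ring
  simp only [i1, i2, i3] at hE
  unfold funCoeff RealCircleDistribution.coeff
  rw [Fin.sum_univ_two] at hE ⊢
  generalize (∫ x in (0 : ℝ)..(2 * Real.pi), expMode (-m) x * ψ x) = I₁ at hE ⊢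
  generalize (∫ x in (0 : ℝ)..(2 * Real.pi), expMode (-m) x * (v x * ψ x)) = I₂ at hE ⊢
  field_simp
  linear_combination -hE

theorem exists_phase_of_norm_eq {a b : ℂ} (h : ‖a‖ = ‖b‖) :
    ∃ θ : ℝ, a = Complex.exp (θ * Complex.I) * b := by
  refine ⟨(a / b).arg, ?_⟩
  by_cases hb : b = 0
  · subst hb; simpa using h
  have hb' : ‖b‖ ≠ 0 := norm_ne_zero_iff.mpr hb
  have := Complex.norm_mul_exp_arg_mul_I (a / b)
  rw [norm_div, h, div_self hb', Complex.ofReal_one, one_mul] at this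
  rw [this, div_mul_cancel₀ _ hb]

/-! ### Bounds on the coefficients of `α`. -/

namespace NonDegenerate

variable {α : Fin 2 → RealCircleDistribution} {c₀ c₁ c₂ : ℝ}

theorem le_coeffSupSq (h : NonDegenerate α c₀ c₁ c₂) (n : ℤ) :
    ∑ i, ‖(α i).coeff n‖ ^ 2 ≤ coeffSupSq α := by
  have hc₂ : 0 < c₂ := h.c₁_pos.trans h.c₁_lt_c₂
  refine le_ciSup (f := fun n : ℤ => ∑ i, ‖(α i).coeff n‖ ^ 2)
    -- Non-degeneracy says nothing at `n = 0`, so that term enters the upper bound separately.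
    ⟨max (c₀ / c₂) (∑ i, ‖(α i).coeff 0‖ ^ 2), ?_⟩ n
  rintro _ ⟨m, rfl⟩
  by_cases hm : m = 0
  · subst hm; exact le_max_right _ _
  · refine le_max_of_le_left ?_
    rw [le_div_iff₀ hc₂, mul_comm]
    exact h.bounded m hm

theorem coeffSupSq_pos (h : NonDegenerate α c₀ c₁ c₂) : 0 < coeffSupSq α := by
  have h1 := (h.c₁_pos.trans_le (h.lower 1 one_ne_zero)).trans_le (h.upper 1 one_ne_zero)
  exact (pos_of_mul_pos_right h1 (h.c₁_pos.trans h.c₁_lt_c₂).le).trans_le (h.le_coeffSupSq 1)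

theorem norm_coeff_le (h : NonDegenerate α c₀ c₁ c₂) (i : Fin 2) (n : ℤ) :
    ‖(α i).coeff n‖ ≤ Real.sqrt (coeffSupSq α) :=
  Real.le_sqrt_of_sq_le <| (Finset.single_le_sum (f := fun i => ‖(α i).coeff n‖ ^ 2)
    (fun _ _ => by positivity) (Finset.mem_univ i)).trans (h.le_coeffSupSq n)

end NonDegenerate

/-! ### Estimates for eigenfunctions. -/

namespace IsNormalizedEigenfunction

variable {α : Fin 2 → RealCircleDistribution} {v : ℝ → ℝ} {ε μ : ℂ} {ψ : ℝ → ℂ}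

theorem summable (h : IsNormalizedEigenfunction α v ε μ ψ) : Summable fun m => ‖funCoeff ψ m‖ :=
  summable_norm_of_sobolev h.sobolev

theorem hasSum_sq (h : IsNormalizedEigenfunction α v ε μ ψ) :
    HasSum (fun m => ‖funCoeff ψ m‖ ^ 2) 1 := by
  have h1 := hasSum_star_funCoeff_mul h.continuous h.periodic h.summable h.continuous
  have h2 : (∫ x in (0 : ℝ)..(2 * Real.pi), star (ψ x) * ψ x) = ((1 : ℝ) : ℂ) := by
    have h3 := h.normalized
    unfold circleL2Norm at h3
    rw [Real.sqrt_eq_one] at h3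
    rw [← h3, ← intervalIntegral.integral_ofReal]
    congr 1; ext x
    rw [Complex.star_def, Complex.conj_mul']; push_cast; rfl
  rw [h2] at h1
  refine Complex.hasSum_ofReal.mp (h1.congr_fun fun m => ?_)
  rw [Complex.star_def, Complex.conj_mul']; push_cast; rfl

theorem norm_funCoeff_le_one (h : IsNormalizedEigenfunction α v ε μ ψ) (m : ℤ) :
    ‖funCoeff ψ m‖ ≤ 1 := by
  have := le_hasSum h.hasSum_sq m (fun _ _ => by positivity)
  exact (sq_le_one_iff₀ (norm_nonneg _)).mp this

theorem approxSolution (h : IsNormalizedEigenfunction α v ε μ ψ) (hv : Continuous v) {r V : ℝ}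
    (hr : ∀ i m, ‖(α i).coeff m‖ ≤ r) (hV : ∀ x, |v x| ≤ V) (hε : ‖ε‖ ≤ 1) :
    ApproxSolution (fun i => (α i).coeff) r V 0 ε μ (funCoeff ψ)
      (funCoeff fun x => v x * ψ x) where
  r_nonneg := (norm_nonneg _).trans (hr 0 0)
  e_nonneg := (abs_nonneg _).trans (hV 0)
  coeff_le := hr
  eps_le := hε
  summable := h.summable
  w_le := norm_funCoeff_mul_le hV h.continuous h.periodic h.summable
  eqn m := by
    have := h.coeff_eq hv m
    unfold RealCircleDistribution.pair at this
    unfold seqPair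
    rw [this, norm_zero]

/-- The imaginary part of an eigenvalue comes from the rank two perturbation. -/
theorem im_eigenvalue (h : IsNormalizedEigenfunction α v ε μ ψ) (hv : Continuous v) {r : ℝ}
    (hr : ∀ i m, ‖(α i).coeff m‖ ≤ r) :
    μ.im = -(ε.im * ∑ i, ‖(α i).pair ψ‖ ^ 2) := by
  have hvψ : Continuous fun x => (v x : ℂ) * ψ x :=
    (Complex.continuous_ofReal.comp hv).mul h.continuous
  have hV := hasSum_star_funCoeff_mul h.continuous h.periodic h.summable hvψ
  have hVr : (∫ x in (0 : ℝ)..(2 * Real.pi), star (ψ x) * (v x * ψ x))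
      = ((∫ x in (0 : ℝ)..(2 * Real.pi), v x * ‖ψ x‖ ^ 2 : ℝ) : ℂ) := by
    rw [← intervalIntegral.integral_ofReal]
    congr 1; ext x
    rw [mul_left_comm, Complex.star_def, Complex.conj_mul']; push_cast; rfl
  rw [hVr] at hV
  have hp (i) : HasSum (fun m => (α i).pair ψ * star (star ((α i).coeff m) * funCoeff ψ m))
      ((α i).pair ψ * star ((α i).pair ψ)) :=
    ((summable_star_mul (hr i) h.summable).hasSum.star).mul_left _
  have hP := (hasSum_sum (s := Finset.univ) fun i _ => hp i).mul_left ε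
  have hT := (hV.add hP).neg
  have hT' := (Complex.hasSum_im hT).congr_fun (g := fun m => μ.im * ‖funCoeff ψ m‖ ^ 2)
    fun m => by
      -- Multiply the equation by the conjugate coefficient, take imaginary parts and sum over `m`:
      -- the potential term has a real sum, and `m² + 1` is real.
      have e := h.coeff_eq hv m
      have e2 : (μ + ((m : ℂ) ^ 2 + 1)) * ((‖funCoeff ψ m‖ ^ 2 : ℝ) : ℂ)
          = -(star (funCoeff ψ m) * funCoeff (fun x => v x * ψ x) m
            + ε * ∑ i, (α i).pair ψ * star (star ((α i).coeff m) * funCoeff ψ m)) := by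
        rw [Complex.ofReal_pow, ← Complex.conj_mul', ← Complex.star_def]
        simp only [Fin.sum_univ_two, star_mul', star_star] at e ⊢
        linear_combination (star (funCoeff ψ m)) * e
      rw [← e2, Complex.im_mul_ofReal]
      have : ((m : ℂ) ^ 2).im = 0 := by
        rw [← Complex.ofReal_intCast, ← Complex.ofReal_pow, Complex.ofReal_im]
      simp [this]
  have hU := hT'.unique (h.hasSum_sq.mul_left μ.im)
  have hr2 : ∑ i, (α i).pair ψ * star ((α i).pair ψ) = ((∑ i, ‖(α i).pair ψ‖ ^ 2 : ℝ) : ℂ) := by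
    push_cast
    exact Finset.sum_congr rfl fun i _ => by rw [Complex.star_def, Complex.mul_conj']
  rw [hr2, Complex.neg_im, Complex.add_im, Complex.ofReal_im, zero_add, Complex.im_mul_ofReal,
    mul_one] at hU
  exact hU.symm

theorem summable_conj (h : IsNormalizedEigenfunction α v ε μ ψ) :
    Summable fun m => ‖star (funCoeff ψ (-m))‖ := by
  simp only [norm_star]
  exact ((Equiv.neg ℤ).summable_iff (f := fun m => ‖funCoeff ψ m‖)).mpr h.summable

theorem continuous_conj (h : IsNormalizedEigenfunction α v ε μ ψ) :
    Continuous fun x => star (ψ x) :=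
  continuous_star.comp h.continuous

theorem continuous_sub_conj (h : IsNormalizedEigenfunction α v ε μ ψ) (c : ℂ) :
    Continuous fun x => ψ x - c * star (ψ x) :=
  h.continuous.sub (continuous_const.mul h.continuous_conj)

theorem periodic_sub_conj (h : IsNormalizedEigenfunction α v ε μ ψ) (c : ℂ) :
    Function.Periodic (fun x => ψ x - c * star (ψ x)) (2 * Real.pi) :=
  fun x => by simp only [h.periodic x]

theorem funCoeff_sub_conj (h : IsNormalizedEigenfunction α v ε μ ψ) (c : ℂ) (m : ℤ) :
    funCoeff (fun x => ψ x - c * star (ψ x)) m = funCoeff ψ m - c * star (funCoeff ψ (-m)) := by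
  rw [funCoeff_sub_mul h.continuous h.continuous_conj, funCoeff_star]

theorem summable_sub_conj (h : IsNormalizedEigenfunction α v ε μ ψ) (c : ℂ) :
    Summable fun m => ‖funCoeff (fun x => ψ x - c * star (ψ x)) m‖ := by
  simp only [h.funCoeff_sub_conj]
  refine Summable.of_nonneg_of_le (fun _ => norm_nonneg _) (fun m => norm_sub_le _ _) ?_
  simp only [norm_mul]
  exact h.summable.add (h.summable_conj.mul_left _)

/-- The difference of an eigenfunction and a multiple of its conjugate solves the eigenvalue
equation up to an error proportional to `Im ε`. -/
theorem approxSolution_sub_conj (h : IsNormalizedEigenfunction α v ε μ ψ) (hv : Continuous v)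
    {r V N : ℝ} (hr : ∀ i m, ‖(α i).coeff m‖ ≤ r) (hV : ∀ x, |v x| ≤ V) (hε : ‖ε‖ ≤ 1)
    (hN : ∑' m, ‖funCoeff ψ m‖ ≤ N) {c : ℂ} (hc : ‖c‖ = 1) :
    ApproxSolution (fun i => (α i).coeff) r V (|ε.im| * (4 * (r * N) ^ 2 + 4 * (r * (r * N)))) ε μ
      (funCoeff fun x => ψ x - c * star (ψ x))
      (funCoeff fun x => v x * (ψ x - c * star (ψ x))) where
  r_nonneg := (norm_nonneg _).trans (hr 0 0)
  e_nonneg := (abs_nonneg _).trans (hV 0)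
  coeff_le := hr
  eps_le := hε
  summable := h.summable_sub_conj c
  w_le := norm_funCoeff_mul_le hV (h.continuous_sub_conj c) (h.periodic_sub_conj c)
    (h.summable_sub_conj c)
  eqn m := by
    have hr0 : 0 ≤ r := (norm_nonneg _).trans (hr 0 0)
    have hpr (i) : ‖(α i).pair ψ‖ ≤ r * N :=
      (norm_seqPair_le (hr i) h.summable).trans (by gcongr)
    have hw : funCoeff (fun x => v x * (ψ x - c * star (ψ x))) m
        = funCoeff (fun x => v x * ψ x) m - c * star (funCoeff (fun x => v x * ψ x) (-m)) := by
      have hv' : Continuous fun x => (v x : ℂ) := Complex.continuous_ofReal.comp hv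
      have hvψ : Continuous fun x => (v x : ℂ) * ψ x := hv'.mul h.continuous
      have hvψ' : Continuous fun x => star ((v x : ℂ) * ψ x) := continuous_star.comp hvψ
      rw [← funCoeff_star, ← funCoeff_sub_mul hvψ hvψ']
      congr 1; ext x
      rw [star_mul', Complex.star_def, Complex.conj_ofReal]; ring
    have hpχ (i) : seqPair (α i).coeff (funCoeff fun x => ψ x - c * star (ψ x))
        = (α i).pair ψ - c * star ((α i).pair ψ) := by
      have s1 := (summable_star_mul (hr i) h.summable).hasSum
      have s2 := ((Equiv.neg ℤ).hasSum_iff.mpr s1.star).mul_left c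
      refine ((s1.sub s2).congr_fun fun k => ?_).tsum_eq
      simp only [Function.comp_apply, Equiv.neg_apply, h.funCoeff_sub_conj, star_mul', star_star,
        (α i).coeff_neg]
      ring
    have e1 := h.coeff_eq hv m
    -- The conjugate of the equation at `-m` is the equation at `m` for `ψ*`, with `μ` and `ε`
    -- conjugated. Subtracting `c` times it leaves an error from `μ* - μ` and `ε* - ε` only.
    have e2 := congrArg star (h.coeff_eq hv (-m))
    simp only [Fin.sum_univ_two, star_add, star_mul', (α _).coeff_neg, star_star, star_zero] at e2
    have hm : star (((-m : ℤ) : ℂ) ^ 2) = (m : ℂ) ^ 2 := by simp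
    rw [hm, star_one] at e2
    have hμ : ‖star μ - μ‖ = 2 * |μ.im| := by
      have : star μ - μ = ((-2 * μ.im : ℝ) : ℂ) * Complex.I := by
        apply Complex.ext <;> simp; ring
      rw [this, norm_mul, Complex.norm_I, Complex.norm_real, mul_one, norm_mul]; norm_num
    have hεε : ‖star ε - ε‖ = 2 * |ε.im| := by
      have : star ε - ε = ((-2 * ε.im : ℝ) : ℂ) * Complex.I := by
        apply Complex.ext <;> simp; ring
      rw [this, norm_mul, Complex.norm_I, Complex.norm_real, mul_one, norm_mul]; norm_num
    have key : (μ + ((m : ℂ) ^ 2 + 1)) * funCoeff (fun x => ψ x - c * star (ψ x)) m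
        + funCoeff (fun x => v x * (ψ x - c * star (ψ x))) m
        + ε * ∑ i, (α i).coeff m * seqPair (α i).coeff (funCoeff fun x => ψ x - c * star (ψ x))
        = c * ((star μ - μ) * star (funCoeff ψ (-m))
          + (star ε - ε) * ∑ i, (α i).coeff m * star ((α i).pair ψ)) := by
      rw [hw, h.funCoeff_sub_conj]
      simp only [hpχ, Fin.sum_univ_two] at e1 ⊢
      linear_combination e1 - c * e2
    rw [key, norm_mul, hc, one_mul]
    refine (norm_add_le _ _).trans ?_
    rw [norm_mul, norm_mul, norm_star, hμ, hεε]
    have b1 := norm_sum_two_mul_le (b := fun i => (α i).coeff m)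
      (p := fun i => star ((α i).pair ψ)) hr0 (fun i => hr i m) (fun i => by
        rw [norm_star]; exact hpr i)
    have b2 : |μ.im| ≤ |ε.im| * (2 * (r * N) ^ 2) := by
      rw [h.im_eigenvalue hv hr, abs_neg, abs_mul]
      gcongr
      rw [abs_of_nonneg (by positivity), Fin.sum_univ_two, two_mul]
      gcongr <;> exact hpr _
    have b3 := h.norm_funCoeff_le_one (-m)
    calc _ ≤ 2 * (|ε.im| * (2 * (r * N) ^ 2)) * 1 + 2 * |ε.im| * (2 * (r * (r * N))) := by
          gcongr
      _ = _ := by ring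

/-- Hölder continuity of an eigenfunction of level `±n`. -/
theorem norm_sub_le_of_level (h : IsNormalizedEigenfunction α v ε μ ψ) {n : ℤ} {Q γ : ℝ}
    (hQ : ∀ m : ℤ, ‖offLevel n (funCoeff ψ) m‖ ≤ Q / |(m : ℝ) ^ 2 - (n : ℝ) ^ 2|)
    (h0 : 0 ≤ γ) (h1 : γ < 1) (x y : ℝ) :
    ‖ψ x - ψ y‖
      ≤ 2 * (|(n : ℝ)| * |x - y|) + 4 * Q * absPowSum γ * |x - y| ^ γ := by
  have hQ0 : 0 ≤ Q := by
    -- The index `|n| + 1` is off the level, so the denominator is positive and the sign of `Q` can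
    -- be read off.
    have := (norm_nonneg _).trans (hQ (|n| + 1))
    by_contra! hneg
    have hp : 0 < |((|n| + 1 : ℤ) : ℝ) ^ 2 - (n : ℝ) ^ 2| := by
      rw [← sq_abs (n : ℝ)]; push_cast
      apply abs_pos_of_pos
      nlinarith [abs_nonneg (n : ℝ)]
    exact absurd this (not_le.mpr (div_neg_of_neg_of_pos hneg hp))
  set d : ℤ → ℂ := fun m => funCoeff ψ m * (expMode m x - expMode m y) with hd
  have hds : Summable fun m => ‖d m‖ := by
    refine Summable.of_nonneg_of_le (fun _ => norm_nonneg _) (fun m => ?_) (h.summable.mul_right 2)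
    rw [hd, norm_mul]
    gcongr
    have := norm_sub_le (expMode m x) (expMode m y)
    rw [norm_expMode, norm_expMode] at this
    linarith
  have hle : ‖ψ x - ψ y‖ ≤ ∑' m, ‖d m‖ := by
    have := (hasSum_funCoeff_mul_expMode h.continuous h.periodic h.summable x).sub
      (hasSum_funCoeff_mul_expMode h.continuous h.periodic h.summable y)
    rw [← this.tsum_eq]
    refine tsum_of_norm_bounded hds.hasSum fun m => ?_
    rw [← sub_div, ← mul_sub, norm_div, Complex.norm_real, Real.norm_of_nonneg (Real.sqrt_nonneg _)]
    exact div_le_self (norm_nonneg _) sqrt_two_pi_ge_one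
  have hone (m : ℤ) : ‖d m‖ ≤ |(m : ℝ)| * |x - y| := by
    rw [hd, norm_mul]
    have := mul_le_mul (h.norm_funCoeff_le_one m) (norm_expMode_sub_le m x y) (norm_nonneg _)
      zero_le_one
    linarith
  have hoff (m : ℤ) : ‖offLevel n d m‖
      ≤ 2 * Q * |x - y| ^ γ * (|(m : ℝ)| ^ γ / |(m : ℝ) ^ 2 - (n : ℝ) ^ 2|) := by
    have e : offLevel n d m = offLevel n (funCoeff ψ) m * (expMode m x - expMode m y) := by
      unfold offLevel; split_ifs <;> simp [hd]
    rw [e, norm_mul]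
    calc _ ≤ Q / |(m : ℝ) ^ 2 - (n : ℝ) ^ 2| * (2 * (|(m : ℝ)| ^ γ * |x - y| ^ γ)) :=
          mul_le_mul (hQ m) (norm_expMode_sub_le_rpow h0 h1.le m x y) (norm_nonneg _)
            (by positivity)
      _ = _ := by ring
  have htail : ∑' m, ‖offLevel n d m‖ ≤ 2 * Q * |x - y| ^ γ * (2 * absPowSum γ) := by
    calc _ ≤ ∑' m : ℤ, 2 * Q * |x - y| ^ γ * (|(m : ℝ)| ^ γ / |(m : ℝ) ^ 2 - (n : ℝ) ^ 2|) :=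
          (summable_offLevel hds).tsum_le_tsum hoff ((summable_abs_rpow_div h0 h1 n).mul_left _)
      _ ≤ _ := by
          rw [tsum_mul_left]
          gcongr
          exact tsum_abs_rpow_div_le h0 h1 n
  -- The two resonant modes have coefficients at most 1 and give the Lipschitz term `2 |n| |x - y|`.
  have h2 := hone n
  have h3 := hone (-n)
  rw [Int.cast_neg, abs_neg] at h3
  linarith [tsum_norm_le_offLevel hds n]

/-- An eigenfunction of level `±n` is real up to a phase and an error proportional to `Im ε`. -/
theorem exists_phase (h : IsNormalizedEigenfunction α v ε μ ψ) (hv : Continuous v)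
    {r V N c₁ : ℝ} (hr : ∀ i m, ‖(α i).coeff m‖ ≤ r) (hV : ∀ x, |v x| ≤ V) (hε : ‖ε‖ ≤ 1)
    (hε' : 1 / 2 ≤ ‖ε‖) (hN : ∑' m, ‖funCoeff ψ m‖ ≤ N) (hc₁ : 0 < c₁)
    (hq : ∀ n : ℤ, n ≠ 0 → c₁ ≤ ‖∑ i, (α i).coeff n * (α i).coeff n‖)
    (s1 : 4 * absPowSum 0 * (V + 2 * r ^ 2) ≤ 1 / 4) (s2 : 4 * V ≤ c₁ / 8)
    (s3 : 8 * r ^ 2 * (4 * absPowSum 0 * (V + 2 * r ^ 2)) ≤ c₁ / 8)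
    {n : ℤ} (hn : ‖μ + ((n : ℂ) ^ 2 + 1)‖ < 1 / 2) :
    ∃ θ : ℝ, circleL2Norm (fun x => ψ x - Complex.exp (θ * Complex.I) * star (ψ x))
      ≤ 2 * (4 * absPowSum 0 + 4 / c₁ * (1 + 2 * r ^ 2 * (4 * absPowSum 0)))
        * (|ε.im| * (4 * (r * N) ^ 2 + 4 * (r * (r * N)))) := by
  have hlev := sq_sub_sq_le_of_level hn
  set S := 4 * absPowSum 0 with hS
  have hS0 : 0 ≤ S := by have := absPowSum_nonneg 0; positivity
  set G := |ε.im| * (4 * (r * N) ^ 2 + 4 * (r * (r * N)))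
  -- It suffices to control the modes `±n` of the difference. Its `ℓ¹` norm `M` then satisfies `M ≤
  -- (1/4 + 1/8 + 1/8) M + const · G`; absorbing `M / 2` produces the leading factor 2 of the claim.
  suffices hmain : ∃ θ : ℝ,
      ‖funCoeff (fun x => ψ x - Complex.exp (θ * Complex.I) * star (ψ x)) n‖
        + ‖funCoeff (fun x => ψ x - Complex.exp (θ * Complex.I) * star (ψ x)) (-n)‖
      ≤ 4 / c₁ * (V * ∑' k, ‖funCoeff (fun x => ψ x - Complex.exp (θ * Complex.I) * star (ψ x)) k‖
        + G + 2 * r ^ 2 * (S * ((V + 2 * r ^ 2)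
          * ∑' k, ‖funCoeff (fun x => ψ x - Complex.exp (θ * Complex.I) * star (ψ x)) k‖ + G))) by
    obtain ⟨θ, hθ⟩ := hmain
    refine ⟨θ, ?_⟩
    have ha := h.approxSolution_sub_conj hv hr hV hε hN (Complex.norm_exp_ofReal_mul_I θ)
    have hle := circleL2Norm_le_tsum_funCoeff (h.continuous_sub_conj (Complex.exp (θ * Complex.I)))
      (h.periodic_sub_conj _) (h.summable_sub_conj _)
    refine hle.trans ?_
    have hb := ha.tsum_le_of_level hlev
    rw [← hS] at hb
    have hM : 0 ≤ ∑' k, ‖funCoeff (fun x => ψ x - Complex.exp (θ * Complex.I) * star (ψ x)) k‖ :=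
      tsum_nonneg fun _ => norm_nonneg _
    set M := ∑' k, ‖funCoeff (fun x => ψ x - Complex.exp (θ * Complex.I) * star (ψ x)) k‖
    have t1 : S * (V + 2 * r ^ 2) * M ≤ 1 / 4 * M := by gcongr
    have t2 : 4 / c₁ * V * M ≤ 1 / 8 * M := by
      gcongr
      rw [div_mul_eq_mul_div, div_le_iff₀ hc₁]; linarith
    have t3 : 4 / c₁ * (2 * r ^ 2 * (S * (V + 2 * r ^ 2))) * M ≤ 1 / 8 * M := by
      gcongr
      rw [div_mul_eq_mul_div, div_le_iff₀ hc₁]; linarith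
    linarith
  by_cases hn0 : n = 0
  · subst hn0
    -- At level 0 there is one mode only, and the phase is chosen to cancel it in the difference.
    obtain ⟨θ, hθ⟩ := exists_phase_of_norm_eq (a := funCoeff ψ 0) (b := star (funCoeff ψ 0))
      (norm_star _).symm
    refine ⟨θ, ?_⟩
    have ha := h.approxSolution_sub_conj hv hr hV hε hN (Complex.norm_exp_ofReal_mul_I θ)
    have hG := ha.G_nonneg
    have hV0 := ha.e_nonneg
    have hx : funCoeff (fun x => ψ x - Complex.exp (θ * Complex.I) * star (ψ x)) 0 = 0 := by
      rw [h.funCoeff_sub_conj, neg_zero, sub_eq_zero]; exact hθ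
    rw [neg_zero, hx, norm_zero, add_zero]
    have hM : 0 ≤ ∑' k, ‖funCoeff (fun x => ψ x - Complex.exp (θ * Complex.I) * star (ψ x)) k‖ :=
      tsum_nonneg fun _ => norm_nonneg _
    positivity
  · set q := ∑ i, (α i).coeff n * (α i).coeff n with hqdef
    have hq0 : q ≠ 0 := norm_pos_iff.mp (hc₁.trans_le (hq n hn0))
    obtain ⟨s, hs, hsε⟩ := exists_sign_le
      (Λ := μ + ((n : ℂ) ^ 2 + 1) + ε * ∑ i, (α i).coeff n * star ((α i).coeff n)) (ε := ε) (q := q)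
    -- The sign `s` depends on `μ`, `ε` and `α` but not on the phase. The possibly resonant
    -- combination for `ψ*` is the conjugate of the one for `ψ` times a unimodular number, so a
    -- suitable `θ` makes the two cancel.
    have hconj : ‖phaseComb q (-s) (funCoeff ψ n) (funCoeff ψ (-n))‖
        = ‖phaseComb q (-s) (star (funCoeff ψ (-n))) (star (funCoeff ψ n))‖ := by
      have hq' : (‖q‖ : ℂ) ≠ 0 := by simpa using hq0
      have hqq : q * star q = (‖q‖ : ℂ) * ‖q‖ := by
        have := Complex.mul_conj' q
        rw [sq] at this; exact this
      have hss : s = 1 ∨ s = -1 := by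
        exact mul_self_eq_one_iff.mp hs
      have hstar : star s = s := by rcases hss with rfl | rfl <;> simp
      have hn1 : ‖-s * (q / (‖q‖ : ℂ))‖ = 1 := by
        have : ‖s‖ = 1 := by rcases hss with rfl | rfl <;> simp
        rw [norm_mul, norm_neg, this, norm_div, Complex.norm_real, norm_norm, one_mul,
          div_self (by simpa using hq0)]
      have e : phaseComb q (-s) (star (funCoeff ψ (-n))) (star (funCoeff ψ n))
          = -s * (q / ‖q‖) * star (phaseComb q (-s) (funCoeff ψ n) (funCoeff ψ (-n))) := by
        unfold phaseComb
        rw [star_add, star_mul', star_mul', star_neg, star_div₀, hstar]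
        have : star (‖q‖ : ℂ) = ‖q‖ := Complex.conj_ofReal _
        rw [this]
        field_simp
        linear_combination (-(star (funCoeff ψ (-n))) * ‖q‖ * ‖q‖) * hs
          - (star (funCoeff ψ (-n)) * s * s) * hqq
      rw [e, norm_mul, hn1, one_mul, norm_star]
    obtain ⟨θ, hθ⟩ := exists_phase_of_norm_eq hconj
    refine ⟨θ, ?_⟩
    have ha := h.approxSolution_sub_conj hv hr hV hε hN (Complex.norm_exp_ofReal_mul_I θ)
    refine ha.norm_level_le (fun i m => (α i).coeff_neg m) hn0 hlev hc₁ (hq n hn0) hε' hs hsε ?_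
    rw [h.funCoeff_sub_conj, h.funCoeff_sub_conj, neg_neg]
    unfold phaseComb at hθ ⊢
    linear_combination hθ

end IsNormalizedEigenfunction

/-! ### Choice of constants and conclusion. -/

/-- Reduces negative Hölder exponents to the exponent 0 on a bounded range of distances. -/
theorem rpow_max_le {γ t R : ℝ} (ht : 0 < t) (htR : t ≤ R) :
    t ^ max γ 0 ≤ R ^ (max γ 0 - γ) * t ^ γ := by
  have : t ^ max γ 0 = t ^ (max γ 0 - γ) * t ^ γ := by
    rw [← Real.rpow_add ht]; ring_nf
  rw [this]
  gcongr
  exact sub_nonneg.mpr (le_max_left _ _)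

theorem mainTheorem3 (κ : ℝ) (hκ : 0 < κ) :
    ∃ δ : ℝ, 0 < δ ∧
      ∀ (α : Fin 2 → RealCircleDistribution) (c₀ c₁ c₂ : ℝ),
        NonDegenerate α c₀ c₁ c₂ → κ * coeffSupSq α ≤ c₁ → coeffSupSq α ≤ δ →
        ∃ (ε₀ C c c' : ℝ) (cγ : ℝ → ℝ),
          0 < ε₀ ∧ 0 < C ∧ 0 < c ∧ 0 < c' ∧ (∀ γ < 1, 0 < cγ γ) ∧
          ∀ v : ℝ → ℝ, Continuous v → Function.Periodic v (2 * Real.pi) →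
            (∀ x, |v x| ≤ ε₀ * coeffSupSq α) →
          ∀ ε : ℂ, 1 / 2 ≤ ‖ε‖ → ‖ε‖ ≤ 1 →
          ∀ (μ : ℂ) (ψ : ℝ → ℂ), IsNormalizedEigenfunction α v ε μ ψ →
            (∃ n : ℤ, ‖μ + ((n : ℂ) ^ 2 + 1)‖ < 1 / 2) ∧
            ∀ n : ℤ, ‖μ + ((n : ℂ) ^ 2 + 1)‖ < 1 / 2 →
              (∀ i, ‖(α i).pair ψ‖ ≤ C) ∧
              (∀ x, ‖ψ x‖ ≤ C) ∧
              (∀ γ < 1, ∀ x y : ℝ, |x - y| ≤ 2 * Real.pi →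
                ‖ψ x - ψ y‖ ≤ c * (|(n : ℝ)| * |x - y| + cγ γ * |x - y| ^ γ)) ∧
              (|ε.im| ≤ c' * ε.re → ε.re ≠ 0 →
                ∃ θ : ℝ,
                  circleL2Norm (fun x => ψ x - Complex.exp (θ * Complex.I) * star (ψ x))
                    ≤ c' * |ε.im| * (1 / |ε.re| + 1 / (|(n : ℝ)| + 1))) := by
  set S := 4 * absPowSum 0 with hS
  have hS0 : 0 ≤ S := by have := absPowSum_nonneg 0; positivity
  -- Since `V + 2 r² ≤ 3 A`, the first bound gives `(S + 4)(V + 2 r²) ≤ 1/4`, and the second gives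
  -- `24 S A² ≤ κ A / 8 ≤ c₁ / 8`.
  refine ⟨min (1 / (12 * (S + 4))) (κ / (192 * (S + 4))), by positivity, ?_⟩
  intro α c₀ c₁ c₂ hα hκc hδ
  have hA := hα.coeffSupSq_pos
  set A := coeffSupSq α with hAdef
  have hr := hα.norm_coeff_le
  rw [← hAdef] at hr
  have hr2 : Real.sqrt A ^ 2 = A := Real.sq_sqrt hA.le
  have hr0 : 0 < Real.sqrt A := Real.sqrt_pos.mpr hA
  set r := Real.sqrt A
  have d1 : 12 * (S + 4) * A ≤ 1 := by
    have := hδ.trans (min_le_left _ _)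
    rw [le_div_iff₀ (by positivity)] at this; linarith
  have d2 : 192 * (S + 4) * A ≤ κ := by
    have := hδ.trans (min_le_right _ _)
    rw [le_div_iff₀ (by positivity)] at this; linarith
  have hc₁ := hα.c₁_pos
  -- The value `κ / 32` yields `4 V ≤ κ A / 8 ≤ c₁ / 8`.
  set ε₀ := min 1 (κ / 32) with hε₀
  have hε₀pos : 0 < ε₀ := by positivity
  have hε₀1 : ε₀ ≤ 1 := min_le_left _ _
  have hε₀κ : ε₀ ≤ κ / 32 := min_le_right _ _
  set V := ε₀ * A with hVdef
  have hV0 : 0 ≤ V := by positivity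
  have ht : V + 2 * r ^ 2 ≤ 3 * A := by rw [hr2]; nlinarith
  set K := 2 * (S + 4 / c₁ * (1 + 2 * r ^ 2 * S)) * (4 * (r * 4) ^ 2 + 4 * (r * (r * 4)))
  have hK : 0 < K := by positivity
  refine ⟨ε₀, 4 * r + 4, 2, K,
    fun γ => 48 * A * absPowSum (max γ 0) * (2 * Real.pi) ^ (max γ 0 - γ),
    hε₀pos, by positivity, two_pos, hK, ?_, ?_⟩
  · intro γ hγ
    have := absPowSum_pos (max_lt hγ one_pos)
    have : 0 < (2 * Real.pi) ^ (max γ 0 - γ) := by positivity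
    positivity
  intro v hv _ hvV ε hε' hε μ ψ h
  have ha := h.approxSolution hv hr hvV hε
  have s1 : S * (V + 2 * r ^ 2) ≤ 1 / 4 := by
    have := mul_le_mul_of_nonneg_left ht hS0
    nlinarith
  refine ⟨?_, fun n hn => ?_⟩
  · by_contra! hno
    have hle := ha.tsum_le_zero_of_not_level (by rw [← hS]; nlinarith) hno
    have := circleL2Norm_le_tsum_funCoeff h.continuous h.periodic h.summable
    rw [h.normalized] at this
    linarith
  have hlev := sq_sub_sq_le_of_level hn
  have hM : 0 ≤ ∑' m, ‖funCoeff ψ m‖ := tsum_nonneg fun _ => norm_nonneg _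
  -- With `M` the sum on the left, `M ≤ 1 + 1 + M / 4`.
  have hN : ∑' m, ‖funCoeff ψ m‖ ≤ 4 := by
    have h1 := ha.tsum_le_of_level hlev
    rw [← hS] at h1
    have h2 := mul_le_mul_of_nonneg_right s1 hM
    linarith [h.norm_funCoeff_le_one n, h.norm_funCoeff_le_one (-n)]
  refine ⟨fun i => ?_, fun x => ?_, fun γ hγ x y hxy => ?_, fun _ hre => ?_⟩
  · have h1 := norm_seqPair_le (hr i) h.summable
    have h2 := mul_le_mul_of_nonneg_left hN hr0.le
    change ‖seqPair (α i).coeff (funCoeff ψ)‖ ≤ _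
    linarith
  · have h1 := norm_le_tsum_funCoeff h.continuous h.periodic h.summable x
    have h2 := h1.trans (div_le_self hM sqrt_two_pi_ge_one)
    linarith
  -- Here `24 A = 2 · 3 A · 4`, and `4 · 24 A = 2 · 48 A` explains the constants `c` and `cγ`.
  · have hQ (m : ℤ) : ‖offLevel n (funCoeff ψ) m‖ ≤ 24 * A / |(m : ℝ) ^ 2 - (n : ℝ) ^ 2| := by
      refine (ha.norm_offLevel_le hlev m).trans ?_
      refine div_le_div_of_nonneg_right ?_ (abs_nonneg _)
      have := mul_le_mul ht hN hM (by positivity)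
      linarith
    have h1 := h.norm_sub_le_of_level hQ (le_max_right γ 0) (max_lt hγ one_pos) x y
    have hZ := absPowSum_nonneg (max γ 0)
    rcases (abs_nonneg (x - y)).eq_or_lt with h0 | h0
    · have : x = y := by rwa [eq_comm, abs_eq_zero, sub_eq_zero] at h0
      subst this
      rw [sub_self, norm_zero]
      positivity
    · have h2 := mul_le_mul_of_nonneg_left (rpow_max_le (γ := γ) h0 hxy)
        (show 0 ≤ 4 * (24 * A) * absPowSum (max γ 0) by positivity)
      linarith
  · have s2 : 4 * V ≤ c₁ / 8 := by
      have := mul_le_mul_of_nonneg_right hε₀κ hA.le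
      linarith
    have s3 : 8 * r ^ 2 * (S * (V + 2 * r ^ 2)) ≤ c₁ / 8 := by
      rw [hr2] at ht ⊢
      have h1 := mul_le_mul_of_nonneg_left ht (show 0 ≤ 8 * A * S by positivity)
      have h2 := mul_le_mul_of_nonneg_right d2 hA.le
      nlinarith
    obtain ⟨θ, hθ⟩ := h.exists_phase hv hr hvV hε hε' hN hc₁ hα.lower s1 s2 s3 hn
    refine ⟨θ, hθ.trans ?_⟩
    -- As `|Re ε| ≤ |ε| ≤ 1`, the bracket in the claim is at least 1, so the bound `K |Im ε|` is
    -- enough.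
    have hre1 : 1 ≤ 1 / |ε.re| := by
      rw [le_div_iff₀ (abs_pos.mpr hre), one_mul]
      exact (Complex.abs_re_le_norm ε).trans hε
    have h3 : 0 ≤ 1 / (|(n : ℝ)| + 1) := by positivity
    calc _ = K * |ε.im| * 1 := by rw [← hS]; ring
      _ ≤ _ := by gcongr; linarith
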